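/- Let $Q$ be a quiver (possibly infinite) and, for a ring $R$ (associative with identity, not necessarily commutative), let $(Q,R\text{-}\mathrm{Mod})$ be the category of representations of $Q$ by left $R$-modules, i.e. of functors from the path category of $Q$ to $R\text{-}\mathrm{Mod}$. Assume that $Q$ is a source injective representation quiver: for every ring $S$, a representation $X\in(Q,S\text{-}\mathrm{Mod})$ is injective if and only if $X(v)$ is an injective $S$-module for every vertex $v$ and, for every vertex $v$, the homomorphism $X(v)\to\prod_{s(a)=v}X(t(a))$ induced by the maps $X(a)$, the product being over all arrows $a$ with source $v$, is a split epimorphism. Assume moreover (B) for each vertex $v$ of $Q$ the set $\{t(a)\mid s(a)=v\}$ of targets of arrows starting at $v$ is finite. Let $R$ be a ring and let $(\mathcal T,\mathcal F)$ be a hereditary and faithful torsion theory for $R\text{-}\mathrm{Mod}$, that is, $\mathcal T$ and $\mathcal F$ are classes of modules such that $\operatorname{Hom}(T,F)=0$ for all $T\in\mathcal T$, $F\in\mathcal F$, each class contains every module with this property with respect to the other class, $\mathcal T$ is closed under submodules, and $R\in\mathcal F$. Assume (A) every direct sum of injective modules belonging to $\mathcal F$ is injective. Let $\mathcal T_{cw}$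 be the class of representations $X$ of $Q$ with $X(v)\in\mathcal T$ for all vertices $v$, and let $\mathcal F_{cw}$ be the corresponding torsion free class, i.e. the class of representations $Y$ with $\operatorname{Hom}(X,Y)=0$ for all $X\in\mathcal T_{cw}$. Then every representation $X\in(Q,R\text{-}\mathrm{Mod})$ has an $\mathcal F_{cw}$-cover: a morphism $\psi:X'\to X$ with $X'\in\mathcal F_{cw}$ such that every morphism $Y\to X$ with $Y\in\mathcal F_{cw}$ factors through $\psi$, and such that every endomorphism $f$ of $X'$ with $\psi f=\psi$ is an automorphism. This cover is unique up to isomorphism: if $\psi'':X''\to X$ is another $\mathcal F_{cw}$-cover, there is an isomorphism $e:X'\to X''$ with $\psi'' e=\psi$. -/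

import Mathlib

open CategoryTheory
open scoped DirectSum

universe u

section Torsion

variable {C : Type*} [Category C] [Limits.HasZeroMorphisms C]

/-- A torsion theory (in the sense of Dickson) is a pair `(T, F)` of classes of objects
(torsion and torsion free objects), each of which is the full orthogonal of the other. -/
structure IsTorsionTheory (T F : ObjectProperty C) : Prop where
  hom_eq_zero : ∀ ⦃X Y : C⦄, T X → F Y → ∀ f : X ⟶ Y, f = 0
  torsion_of : ∀ ⦃X : C⦄, (∀ ⦃Y : C⦄, F Y → ∀ f : X ⟶ Y, f = 0) → T X
  torsionFree_of : ∀ ⦃Y : C⦄, (∀ ⦃X : C⦄, T X → ∀ f : X ⟶ Y, f = 0) → F Y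

/-- A torsion theory is hereditary if the torsion class is closed under subobjects. -/
structure IsHereditaryTorsionTheory (T F : ObjectProperty C) : Prop extends
    IsTorsionTheory T F where
  of_mono : ∀ ⦃X Y : C⦄ (i : X ⟶ Y) [Mono i], T Y → T X

/-- The torsion free class of the torsion theory with torsion class `T`: the objects which
receive only zero morphisms from the objects of `T`. -/
def torsionFreeClass (T : ObjectProperty C) : ObjectProperty C :=
  fun Y => ∀ ⦃X : C⦄, T X → ∀ f : X ⟶ Y, f = 0

end Torsion

section Covers

variable {C : Type*} [Category C]

/-- `ψ : X' ⟶ X` is an `F`-precover of `X`. -/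
structure IsPrecover (F : ObjectProperty C) {X' X : C} (ψ : X' ⟶ X) : Prop where
  mem : F X'
  exists_lift : ∀ ⦃Y : C⦄, F Y → ∀ φ : Y ⟶ X, ∃ f : Y ⟶ X', f ≫ ψ = φ

/-- `ψ : X' ⟶ X` is an `F`-cover of `X`. -/
structure IsCover (F : ObjectProperty C) {X' X : C} (ψ : X' ⟶ X) : Prop extends
    IsPrecover F ψ where
  isIso_of_comp_eq : ∀ f : X' ⟶ X', f ≫ ψ = ψ → IsIso f

end Covers

section Representations

/-- The category `(Q, R-Mod)` of representations of the quiver `Q` by left `R`-modules: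
functors from the path category of `Q` to `R`-modules, with natural transformations. -/
abbrev QuiverRep (Q : Type u) [Quiver.{u} Q] (R : Type u) [Ring R] :=
  Paths Q ⥤ ModuleCat.{u} R

namespace QuiverRep

variable {Q : Type u} [Quiver.{u} Q] {R : Type u} [Ring R]

/-- The module `X(v)` at the vertex `v`. -/
abbrev at' (X : QuiverRep Q R) (v : Q) : ModuleCat.{u} R := X.obj ((Paths.of Q).obj v)

/-- The homomorphism `X(a) : X(v) → X(w)` of an arrow `a : v ⟶ w`. -/
def arrowMap (X : QuiverRep Q R) {v w : Q} (a : v ⟶ w) : X.at' v →ₗ[R] X.at' w :=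
  (X.map ((Paths.of Q).map a)).hom

/-- The homomorphism `X(v) → ∏_{s(a) = v} X(t(a))` induced by the maps `X(a)`; the product is
over all arrows `a` starting at `v`. -/
def toPiTarget (X : QuiverRep Q R) (v : Q) :
    X.at' v →ₗ[R] ((a : Σ w : Q, v ⟶ w) → X.at' a.1) :=
  LinearMap.pi fun a => X.arrowMap a.2

end QuiverRep

/-- `Q` is a source injective representation quiver: over every ring, the injective
representations are exactly those `X` for which each `X(v)` is an injective module and each
`X(v) → ∏_{s(a) = v} X(t(a))` is a splitting epimorphism. -/
def IsSourceInjective (Q : Type u) [Quiver.{u} Q] : Prop :=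
  ∀ (R : Type u) [Ring R] (X : QuiverRep Q R),
    Injective X ↔
      (∀ v : Q, Module.Injective R (X.at' v)) ∧
      (∀ v : Q, ∃ s : ((a : Σ w : Q, v ⟶ w) → X.at' a.1) →ₗ[R] X.at' v,
        X.toPiTarget v ∘ₗ s = LinearMap.id)

/-- Each vertex has arrows to only finitely many target vertices. -/
def HasFiniteTargets (Q : Type u) [Quiver.{u} Q] : Prop :=
  ∀ v : Q, {w : Q | Nonempty (v ⟶ w)}.Finite

/-- Any direct sum of modules which are injective and lie in the class `F` is injective. -/
def DirectSumsInjective {R : Type u} [Ring R] (F : ObjectProperty (ModuleCat.{u} R)) : Prop :=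
  ∀ (ι : Type u) (M : ι → ModuleCat.{u} R),
    (∀ i, F (M i) ∧ Module.Injective R (M i)) → Module.Injective R (⨁ i, M i)

/-- The class of representations which are componentwise in the class `T` of modules. -/
def componentwiseTorsion (Q : Type u) [Quiver.{u} Q] {R : Type u} [Ring R]
    (T : ObjectProperty (ModuleCat.{u} R)) : ObjectProperty (QuiverRep Q R) :=
  fun X => ∀ v : Q, T (X.at' v)

/-- The torsion free class of the torsion theory on `(Q, R-Mod)` whose torsion class consists of
the representations that are componentwise in `T`. -/
def componentwiseTorsionFree (Q : Type u) [Quiver.{u} Q] {R : Type u} [Ring R]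
    (T : ObjectProperty (ModuleCat.{u} R)) : ObjectProperty (QuiverRep Q R) :=
  torsionFreeClass (componentwiseTorsion Q T)

end Representations

/-! A hereditary torsion theory is encoded by the Gabriel topology of left ideals `I` with `R ⧸ I`
torsion, and the torsion free representations are those that are torsion free at every vertex. A
Bass-type argument turns (A) into finite type: every dense left ideal contains a finitely generated
dense one (`IsGabrielTopology.isFiniteTypeTopology`). Hence unions of chains of saturated
subrepresentations are saturated, and by Zorn every morphism to `X` from a torsion free
representation factors through a reduced one (`IsGabrielTopology.exists_reduced_factorization`).

Reduced morphisms have two virtues. Their torsion free sources are bounded in size by `X`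
(`IsGabrielTopology.IsReduced.exists_embedding`), so a direct sum over a set of representatives
gives a precover, which can be made reduced. And every morphism over `X` from a reduced object to a
torsion free one is injective.

For the cover, a reduced precover `Y` is embedded in a product `I` of many copies of an injective
`E`, and Zorn yields a maximal torsion free subobject `Z` of `I` with a reduced morphism to `X`,
extending `Y`. An endomorphism `f` of `Z` over `X` is injective. By Cantor `Z` is independent of
some copy of `E`, and this room allows the inclusion of `Z` to be extended along `f` to another
embedding of `Z` in `I` (`exists_mono_extension`). Maximality then makes `f` surjective. -/

/-! ### Gabriel topologies, saturation and finite type. -/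

section GabrielTopology

variable {R : Type u} [Ring R]

/-- A (left) Gabriel topology on a ring, given by its dense left ideals. -/
structure IsGabrielTopology (D : Submodule R R → Prop) : Prop where
  top : D ⊤
  mono : ∀ ⦃I J : Submodule R R⦄, I ≤ J → D I → D J
  colon : ∀ ⦃I : Submodule R R⦄, D I → ∀ r : R, D (I.comap (LinearMap.toSpanSingleton R R r))
  glue : ∀ ⦃I J : Submodule R R⦄, D J →
    (∀ j ∈ J, D (I.comap (LinearMap.toSpanSingleton R R j))) → D I

/-- Every dense left ideal contains a finitely generated dense left ideal. -/
def IsFiniteTypeTopology (D : Submodule R R → Prop) : Prop :=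
  ∀ J, D J → ∃ I ≤ J, I.FG ∧ D I

/-- A module is torsion free if only zero is annihilated by a dense left ideal. -/
def IsTorsFree (D : Submodule R R → Prop) (M : Type*) [AddCommGroup M] [Module R M] : Prop :=
  ∀ (J : Submodule R R) (m : M), D J → (∀ r ∈ J, r • m = 0) → m = 0

namespace IsGabrielTopology

variable {D : Submodule R R → Prop}

theorem inf (hD : IsGabrielTopology D) {I J : Submodule R R} (hI : D I) (hJ : D J) : D (I ⊓ J) :=
  hD.glue hI fun j hj => hD.mono (I := J.comap (LinearMap.toSpanSingleton R R j))
    (fun r hr => ⟨I.smul_mem r hj, hr⟩) (hD.colon hJ j)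

/-- The saturation of a submodule: the elements multiplied into it by a dense left ideal. -/
def saturation (hD : IsGabrielTopology D) {M : Type*} [AddCommGroup M] [Module R M] (N : Submodule R M) :
    Submodule R M where
  carrier := {m | D (N.comap (LinearMap.toSpanSingleton R M m))}
  zero_mem' := hD.mono (fun r _ => by simp) hD.top
  add_mem' {a b} ha hb := hD.mono (fun r hr => by
    simpa using N.add_mem hr.1 hr.2) (hD.inf ha hb)
  smul_mem' c m hm := by
    refine hD.mono ?_ (hD.colon hm c)
    intro r hr
    simpa [mul_smul] using hr

theorem mem_saturation (hD : IsGabrielTopology D) {M : Type*} [AddCommGroup M] [Module R M] {N : Submodule R M} {m : M} :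
    m ∈ hD.saturation N ↔ ∃ J, D J ∧ ∀ r ∈ J, r • m ∈ N :=
  ⟨fun h => ⟨_, h, fun _ hr => hr⟩, fun ⟨_, hJ, h⟩ => hD.mono h hJ⟩

theorem le_saturation (hD : IsGabrielTopology D) {M : Type*} [AddCommGroup M] [Module R M] (N : Submodule R M) :
    N ≤ hD.saturation N := fun _ hm =>
  hD.mem_saturation.2 ⟨⊤, hD.top, fun r _ => N.smul_mem r hm⟩

theorem saturation_saturated (hD : IsGabrielTopology D) {M : Type*} [AddCommGroup M] [Module R M] {N : Submodule R M}
    {J : Submodule R R} (hJ : D J) {m : M} (h : ∀ r ∈ J, r • m ∈ hD.saturation N) :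
    m ∈ hD.saturation N := by
  refine hD.glue hJ fun j hj => hD.mono ?_ (h j hj)
  intro r hr
  simpa [mul_smul] using hr

theorem _root_.isTorsFree_quotient {M : Type*} [AddCommGroup M] [Module R M] {N : Submodule R M}
    (hN : ∀ (J : Submodule R R) (m : M), D J → (∀ r ∈ J, r • m ∈ N) → m ∈ N) :
    IsTorsFree D (M ⧸ N) := by
  intro J m hJ
  obtain ⟨m, rfl⟩ := N.mkQ_surjective m
  intro h
  have : m ∈ N := hN J m hJ fun r hr => by
    have := h r hr
    rwa [← map_smul, Submodule.mkQ_apply, Submodule.Quotient.mk_eq_zero] at this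
  simpa using this

end IsGabrielTopology

theorem Submodule.exists_maximal_disjoint {M : Type*} [AddCommGroup M] [Module R M]
    {A B : Submodule R M} (h : Disjoint A B) :
    ∃ C, A ≤ C ∧ Disjoint C B ∧ ∀ C', C ≤ C' → Disjoint C' B → C' ≤ C := by
  obtain ⟨C, hAC, hC⟩ := zorn_le_nonempty₀ {C : Submodule R M | Disjoint C B}
    (fun c hc hchain y hy => ⟨sSup c, by
      have : DirectedOn (· ≤ ·) c := hchain.directedOn
      exact (this.disjoint_sSup_left).2 hc, fun z hz => le_sSup hz⟩) A h
  exact ⟨C, hAC, hC.1, fun C' h1 h2 => hC.2 h2 h1⟩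

/-- For a Gabriel topology, torsion free modules embed into torsion free injective modules. -/
theorem IsGabrielTopology.exists_injective_embedding {D : Submodule R R → Prop}
    (hD : IsGabrielTopology D) (M : Type u) [AddCommGroup M] [Module R M]
    (hM : IsTorsFree D M) :
    ∃ (E : ModuleCat.{u} R) (i : M →ₗ[R] E), Module.Injective R E ∧ IsTorsFree D E ∧
      Function.Injective i := by
  let E : ModuleCat.{u} R := Injective.under (ModuleCat.of R M)
  have : Injective (ModuleCat.of R E) := Injective.injective_under (ModuleCat.of R M)
  have hE : Module.Injective R E := Module.injective_module_of_injective_object R E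
  let i : M →ₗ[R] E := (Injective.ι (ModuleCat.of R M)).hom
  have hi : Function.Injective i := (ModuleCat.mono_iff_injective _).1 inferInstance
  have hdis : Disjoint (hD.saturation (⊥ : Submodule R E)) (LinearMap.range i) := by
    rw [Submodule.disjoint_def]
    rintro _ h ⟨m, rfl⟩
    obtain ⟨J, hJ, h⟩ := hD.mem_saturation.1 h
    have : m = 0 := hM J m hJ fun r hr => hi (by simpa using h r hr)
    simp [this]
  -- The aim is a decomposition `E = C ⊕ P` with `C` containing the torsion of `E` and missing `M`:
  -- then `P` is injective and torsion free, and `M` embeds in it along `C`.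
  obtain ⟨C, hAC, hC, hCmax⟩ := Submodule.exists_maximal_disjoint hdis
  obtain ⟨P, -, hP, hPmax⟩ := Submodule.exists_maximal_disjoint (disjoint_bot_left (a := C))
  obtain ⟨h, hh⟩ := hE.out (P.mkQ ∘ₗ C.subtype) (by
    rw [← LinearMap.ker_eq_bot, Submodule.eq_bot_iff]
    rintro ⟨c, hc⟩ hx
    have : c ∈ P := by simpa using hx
    exact Subtype.ext (Submodule.disjoint_def.1 hP c this hc)) C.subtype
  -- `p` is the identity on `C` and zero on `P`. The two maximality properties force its range into
  -- `C` and its kernel to be `P`, so it is the projection onto `C`.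
  let p : E →ₗ[R] E := h ∘ₗ P.mkQ
  have hpC : ∀ c ∈ C, p c = c := fun c hc => hh ⟨c, hc⟩
  have hpP : ∀ x ∈ P, p x = 0 := fun x hx => by
    simp [p, (Submodule.Quotient.mk_eq_zero P).2 hx]
  have hpM : (LinearMap.range i).comap p ≤ P := by
    refine hPmax _ (fun x hx => ⟨0, by simp [hpP x hx]⟩) ?_
    rw [Submodule.disjoint_def]
    intro x hx hxC
    refine Submodule.disjoint_def.1 hC x hxC ?_
    rw [← hpC x hxC]
    exact hx
  have hpmem : ∀ x, p x ∈ C := by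
    have : LinearMap.range p ≤ C := by
      refine hCmax _ (fun c hc => ⟨c, hpC c hc⟩) ?_
      rw [Submodule.disjoint_def]
      rintro _ ⟨x, rfl⟩ hx
      exact hpP x (hpM hx)
    exact fun x => this ⟨x, rfl⟩
  have hker : ∀ x, x - p x ∈ P := fun x => hpM ⟨0, by simp [hpC _ (hpmem x)]⟩
  let q : E →ₗ[R] P := (LinearMap.id - p).codRestrict P hker
  refine ⟨ModuleCat.of R P, q ∘ₗ i, ⟨fun X Y _ _ _ _ f hf g => ?_⟩, ?_, ?_⟩
  · obtain ⟨k, hk⟩ := hE.out f hf (P.subtype ∘ₗ g)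
    refine ⟨q ∘ₗ k, fun x => Subtype.ext ?_⟩
    have : k (f x) = (g x : E) := hk x
    simp [q, this, hpP _ (g x).2]
  · rintro J ⟨x, hx⟩ hJ hxJ
    refine Subtype.ext (Submodule.disjoint_def.1 hP x hx (hAC ?_))
    exact hD.mem_saturation.2 ⟨J, hJ, fun r hr => by simpa using congrArg Subtype.val (hxJ r hr)⟩
  · rw [← LinearMap.ker_eq_bot, Submodule.eq_bot_iff]
    intro m hm
    have h0 : i m - p (i m) = 0 := congrArg Subtype.val (show q (i m) = 0 from hm)
    have h1 : i m ∈ C := by rw [sub_eq_zero.1 h0]; exact hpmem _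
    exact hi (by simpa using Submodule.disjoint_def.1 hC _ h1 ⟨m, rfl⟩)

/-- If direct sums of torsion free injective modules are injective, then every dense left ideal
contains a finitely generated dense left ideal. -/
theorem IsGabrielTopology.isFiniteTypeTopology {D : Submodule R R → Prop}
    (hD : IsGabrielTopology D)
    (hA : ∀ (ι : Type u) (M : ι → ModuleCat.{u} R),
      (∀ i, IsTorsFree D (M i) ∧ Module.Injective R (M i)) → Module.Injective R (⨁ i, M i)) :
    IsFiniteTypeTopology D := by
  classical
  intro J hJ
  by_contra! hcon
  -- If `J` lay in the saturation of a finitely generated `N ≤ J`, gluing would make `N` dense.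
  have step : ∀ N : {N : Submodule R R // N ≤ J ∧ N.FG}, ∃ x ∈ J, x ∉ hD.saturation N.1 := by
    intro N
    by_contra! h
    exact hcon N.1 N.2.1 N.2.2 (hD.glue hJ h)
  choose x hxJ hx using step
  let N : ℕ → {N : Submodule R R // N ≤ J ∧ N.FG} := fun n =>
    Nat.rec ⟨⊥, bot_le, Submodule.fg_bot⟩
      (fun _ N => ⟨N.1 ⊔ R ∙ x N, sup_le N.2.1 (by simpa using hxJ N),
        N.2.2.sup (Submodule.fg_span_singleton _)⟩) n
  have hNsucc : ∀ n, (N (n + 1)).1 = (N n).1 ⊔ R ∙ x (N n) := fun n => rfl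
  have hmono : Monotone fun n => (N n).1 := monotone_nat_of_le_succ fun n => by
    simp only [hNsucc]; exact le_sup_left
  let I : Submodule R R := ⨆ n, (N n).1
  have hmemI : ∀ r, r ∈ I ↔ ∃ n, r ∈ (N n).1 := fun r =>
    Submodule.mem_iSup_of_directed _ hmono.directed_le
  have hemb := fun n => hD.exists_injective_embedding (R ⧸ hD.saturation (N n).1)
    (isTorsFree_quotient fun _ _ h h' => hD.saturation_saturated h h')
  choose E i hE hEF hi using hemb
  let M : ULift.{u} ℕ → ModuleCat.{u} R := fun n => E n.down
  have hinj : Module.Injective R (⨁ n, M n) := hA _ M fun n => ⟨hEF n.down, hE n.down⟩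
  let c : (⨁ n, M n) →ₗ[R] ((n : ULift.{u} ℕ) → M n) := DFinsupp.coeFnLinearMap R
  have hc : Function.Injective c := DFunLike.coe_injective
  let g : R →ₗ[R] ((n : ULift.{u} ℕ) → M n) :=
    LinearMap.pi fun n => i n.down ∘ₗ (hD.saturation (N n.down).1).mkQ
  have hg0 : ∀ r n, g r n = 0 ↔ r ∈ hD.saturation (N n.down).1 := by
    intro r n
    change i n.down (Submodule.Quotient.mk r) = 0 ↔ _
    rw [map_eq_zero_iff _ (hi n.down), Submodule.Quotient.mk_eq_zero]
  -- An element of `I` lies in some `N n`, so its coordinates vanish from `n` on.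
  have hgI : ∀ r : I, (g ∘ₗ I.subtype) r ∈ LinearMap.range c := by
    rintro ⟨r, hr⟩
    obtain ⟨n, hn⟩ := (hmemI r).1 hr
    let d : ⨁ n, M n := DirectSum.mk _ ((Finset.range n).image ULift.up) fun k => g r k.1
    refine ⟨d, funext fun k => ?_⟩
    change d k = g r k
    by_cases h : k ∈ (Finset.range n).image ULift.up
    · exact DirectSum.mk_apply_of_mem h
    · refine (DirectSum.mk_apply_of_notMem h).trans ((hg0 r k).2 ?_).symm
      refine hD.le_saturation _ (hmono (a := n) (b := k.down) ?_ hn)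
      by_contra! hlt
      exact h (Finset.mem_image.2 ⟨k.down, by simpa using hlt, rfl⟩)
  let e := LinearEquiv.ofInjective c hc
  obtain ⟨h, hh⟩ := hinj.out I.subtype I.subtype_injective
    (e.symm.toLinearMap ∘ₗ (g ∘ₗ I.subtype).codRestrict _ hgI)
  have hgh : ∀ r ∈ I, g r = r • c (h 1) := by
    intro r hr
    have h1 := congrArg c (hh ⟨r, hr⟩)
    have h2 : ∀ y, c (e.symm y) = y := fun y => by
      conv_rhs => rw [← e.apply_symm_apply y]
      rfl
    rw [← map_smul, ← map_smul, smul_eq_mul, mul_one]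
    exact (h1.trans (h2 _)).symm
  -- On `I` the map `g` is multiplication by `h 1`, which has finite support. A coordinate outside
  -- it puts all of `I` in the saturation of `N n`, although `x (N n)` is not there.
  obtain ⟨n, hn⟩ : ∃ n : ULift.{u} ℕ, c (h 1) n = 0 := by
    by_contra! hne
    have : (Set.univ : Set (ULift.{u} ℕ)).Finite :=
      (DFinsupp.finite_support (h 1)).subset fun n _ => hne n
    exact Set.infinite_univ this
  refine hx (N n.down) ((hg0 _ n).1 ?_)
  rw [hgh _ ((hmemI _).2 ⟨n.down + 1, ?_⟩), Pi.smul_apply, hn, smul_zero]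
  rw [hNsucc]
  exact le_sup_right (α := Submodule R R) (Submodule.mem_span_singleton_self _)

end GabrielTopology

/-! ### Subrepresentations, saturated hulls and reduced morphisms. -/

section ModuleRepresentations

variable {R : Type u} [Ring R] {J : Type u} [SmallCategory J]

/-- A subrepresentation of a functor to modules. -/
@[ext]
structure SubRep (Y : J ⥤ ModuleCat.{u} R) where
  carrier : ∀ v, Submodule R (Y.obj v)
  map_mem : ∀ ⦃v w : J⦄ (p : v ⟶ w) ⦃x : Y.obj v⦄, x ∈ carrier v → (Y.map p).hom x ∈ carrier w

namespace SubRep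

variable {Y Z : J ⥤ ModuleCat.{u} R}

instance : PartialOrder (SubRep Y) :=
  PartialOrder.lift SubRep.carrier fun _ _ => SubRep.ext

theorem mem_of_le {M N : SubRep Y} (h : M ≤ N) {v : J} {x : Y.obj v} (hx : x ∈ M.carrier v) :
    x ∈ N.carrier v := h v hx

/-- The representation underlying a subrepresentation. -/
def toRep (N : SubRep Y) : J ⥤ ModuleCat.{u} R where
  obj v := ModuleCat.of R (N.carrier v)
  map p := ModuleCat.ofHom ((Y.map p).hom.restrict (N.map_mem p))
  map_id v := by
    ext x
    exact show (Y.map (𝟙 v)).hom x.1 = x.1 by simp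
  map_comp p q := by
    ext x
    exact show (Y.map (p ≫ q)).hom x.1 = (Y.map q).hom ((Y.map p).hom x.1) by simp

/-- The inclusion of a subrepresentation. -/
def ι (N : SubRep Y) : N.toRep ⟶ Y where
  app v := ModuleCat.ofHom (N.carrier v).subtype

theorem ι_injective (N : SubRep Y) (v : J) : Function.Injective (N.ι.app v).hom :=
  Subtype.val_injective

theorem ι_mem (N : SubRep Y) {v : J} (x : N.toRep.obj v) : (N.ι.app v).hom x ∈ N.carrier v :=
  x.2

theorem exists_ι_eq (N : SubRep Y) {v : J} {x : Y.obj v} (hx : x ∈ N.carrier v) :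
    ∃ z : N.toRep.obj v, (N.ι.app v).hom z = x := ⟨⟨x, hx⟩, rfl⟩

/-- The corestriction of a morphism to a subrepresentation containing its image. -/
def lift (N : SubRep Y) (f : Z ⟶ Y) (h : ∀ v x, (f.app v).hom x ∈ N.carrier v) :
    Z ⟶ N.toRep where
  app v := ModuleCat.ofHom ((f.app v).hom.codRestrict _ (h v))
  naturality v w p := by
    ext x
    exact Subtype.ext (NatTrans.naturality_apply f p x)

/-- The inverse image of a subrepresentation. -/
def comap (f : Z ⟶ Y) (N : SubRep Y) : SubRep Z where
  carrier v := (N.carrier v).comap (f.app v).hom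
  map_mem v w p x hx := by
    have := N.map_mem p hx
    rwa [← NatTrans.naturality_apply f p x] at this

theorem mem_comap {f : Z ⟶ Y} {N : SubRep Y} {v : J} {x : Z.obj v} :
    x ∈ (comap f N).carrier v ↔ (f.app v).hom x ∈ N.carrier v := Iff.rfl

/-- The image of a morphism. -/
def range (f : Z ⟶ Y) : SubRep Y where
  carrier v := LinearMap.range (f.app v).hom
  map_mem := by
    rintro v w p _ ⟨x, rfl⟩
    exact ⟨(Z.map p).hom x, NatTrans.naturality_apply f p x⟩

instance : Bot (SubRep Y) where
  bot := { carrier := fun _ => ⊥, map_mem := fun v w p x hx => by simp_all }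

theorem mem_bot {v : J} {x : Y.obj v} : x ∈ (⊥ : SubRep Y).carrier v ↔ x = 0 :=
  Submodule.mem_bot R

/-- The kernel of a morphism. -/
def ker (f : Z ⟶ Y) : SubRep Z := comap f ⊥

theorem mem_ker {f : Z ⟶ Y} {v : J} {x : Z.obj v} :
    x ∈ (ker f).carrier v ↔ (f.app v).hom x = 0 := Iff.rfl

/-- The union of a nonempty chain of subrepresentations. -/
def chainUnion (c : Set (SubRep Y)) (hc : IsChain (· ≤ ·) c) (hne : c.Nonempty) : SubRep Y where
  carrier v :=
    { carrier := {x | ∃ N ∈ c, x ∈ N.carrier v}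
      zero_mem' := ⟨_, hne.choose_spec, zero_mem _⟩
      add_mem' := by
        rintro a b ⟨N, hN, ha⟩ ⟨M, hM, hb⟩
        rcases hc.total hN hM with h | h
        · exact ⟨M, hM, add_mem (h v ha) hb⟩
        · exact ⟨N, hN, add_mem ha (h v hb)⟩
      smul_mem' := by
        rintro r a ⟨N, hN, ha⟩
        exact ⟨N, hN, Submodule.smul_mem _ _ ha⟩ }
  map_mem := by
    rintro v w p x ⟨N, hN, hx⟩
    exact ⟨N, hN, N.map_mem p hx⟩

theorem le_chainUnion {c : Set (SubRep Y)} {hc : IsChain (· ≤ ·) c} {hne : c.Nonempty}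
    {N : SubRep Y} (hN : N ∈ c) : N ≤ chainUnion c hc hne := fun _ _ hx => ⟨N, hN, hx⟩

/-- The quotient by a subrepresentation. -/
def quotient (N : SubRep Y) : J ⥤ ModuleCat.{u} R where
  obj v := ModuleCat.of R (Y.obj v ⧸ N.carrier v)
  map {v w} p := ModuleCat.ofHom (Submodule.mapQ _ _ (Y.map p).hom fun _ hx => N.map_mem p hx)
  map_id v := by
    ext x
    exact congrArg Submodule.Quotient.mk (by simp : (Y.map (𝟙 v)).hom x = x)
  map_comp p q := by
    ext x
    exact congrArg Submodule.Quotient.mk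
      (by simp : (Y.map (p ≫ q)).hom x = (Y.map q).hom ((Y.map p).hom x))

/-- The projection onto the quotient by a subrepresentation. -/
def π (N : SubRep Y) : Y ⟶ N.quotient where
  app v := ModuleCat.ofHom (N.carrier v).mkQ

theorem π_surjective (N : SubRep Y) (v : J) : Function.Surjective (N.π.app v).hom :=
  Submodule.mkQ_surjective _

theorem π_eq_zero (N : SubRep Y) {v : J} {x : Y.obj v} :
    (N.π.app v).hom x = 0 ↔ x ∈ N.carrier v := Submodule.Quotient.mk_eq_zero _

end SubRep

/-- A morphism vanishing on the kernel of a surjective morphism factors through the latter. -/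
theorem exists_desc_of_surjective {G Y Z : J ⥤ ModuleCat.{u} R} (e : G ⟶ Y)
    (he : ∀ v, Function.Surjective (e.app v).hom) (f : G ⟶ Z)
    (h : ∀ v x, (e.app v).hom x = 0 → (f.app v).hom x = 0) : ∃ g : Y ⟶ Z, e ≫ g = f := by
  have key : ∀ v x, (f.app v).hom (Function.surjInv (he v) ((e.app v).hom x)) =
      (f.app v).hom x := by
    intro v x
    rw [← sub_eq_zero, ← map_sub]
    apply h
    rw [map_sub, Function.surjInv_eq (he v), sub_self]
  refine ⟨{ app := fun v => ModuleCat.ofHom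
              { toFun := fun y => (f.app v).hom (Function.surjInv (he v) y)
                map_add' := fun a b => ?_
                map_smul' := fun r a => ?_ }
            naturality := fun v w p => ?_ }, ?_⟩
  · obtain ⟨a, rfl⟩ := he v a
    obtain ⟨b, rfl⟩ := he v b
    rw [← map_add, key, key, key, map_add]
  · obtain ⟨a, rfl⟩ := he v a
    rw [← map_smul, key, key, map_smul, RingHom.id_apply]
  · ext y
    obtain ⟨x, rfl⟩ := he v y
    have h1 : (Y.map p).hom ((e.app v).hom x) = (e.app w).hom ((G.map p).hom x) :=
      (NatTrans.naturality_apply e p x).symm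
    change (f.app w).hom (Function.surjInv (he w) ((Y.map p).hom ((e.app v).hom x))) =
      (Z.map p).hom ((f.app v).hom (Function.surjInv (he v) ((e.app v).hom x)))
    rw [h1, key, key]
    exact NatTrans.naturality_apply f p x
  · ext v x
    exact key v x

/-- The elements `∑ rₚ • Y(p) y`, where `p` runs through the morphisms `v ⟶ w`. -/
noncomputable def pathComb (Y : J ⥤ ModuleCat.{u} R) {v : J} (y : Y.obj v) (w : J) :
    ((v ⟶ w) →₀ R) →ₗ[R] Y.obj w :=
  Finsupp.linearCombination R fun p => (Y.map p).hom y

theorem pathComb_sub (Y : J ⥤ ModuleCat.{u} R) {v w : J} (y y' : Y.obj v) (c : (v ⟶ w) →₀ R) :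
    pathComb Y (y - y') w c = pathComb Y y w c - pathComb Y y' w c := by
  simp [pathComb, Finsupp.linearCombination_apply, Finsupp.sum, smul_sub]

theorem pathComb_app {Y Z : J ⥤ ModuleCat.{u} R} (f : Y ⟶ Z) {v w : J} (y : Y.obj v)
    (c : (v ⟶ w) →₀ R) :
    (f.app w).hom (pathComb Y y w c) = pathComb Z ((f.app v).hom y) w c := by
  simp only [pathComb, Finsupp.linearCombination_apply, Finsupp.sum, map_sum, map_smul]
  exact Finset.sum_congr rfl fun p _ => congrArg _ (NatTrans.naturality_apply f p y)

theorem map_pathComb (Y : J ⥤ ModuleCat.{u} R) {v w w' : J} (p : w ⟶ w') (y : Y.obj v)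
    (c : (v ⟶ w) →₀ R) :
    (Y.map p).hom (pathComb Y y w c) = pathComb Y y w' (c.mapDomain (· ≫ p)) := by
  simp only [pathComb, Finsupp.linearCombination_mapDomain]
  simp [Finsupp.linearCombination_apply, Finsupp.sum, map_sum, map_smul, Function.comp_def]

theorem pathComb_single_id (Y : J ⥤ ModuleCat.{u} R) {v : J} (y : Y.obj v) :
    pathComb Y y v (Finsupp.single (𝟙 v) 1) = y := by
  simp [pathComb]

variable {D : Submodule R R → Prop}

/-- A representation is torsion free if it is so at every vertex. -/
def IsTorsFreeRep (D : Submodule R R → Prop) (Y : J ⥤ ModuleCat.{u} R) : Prop :=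
  ∀ v, IsTorsFree D (Y.obj v)

theorem IsTorsFreeRep.of_injective {Y Z : J ⥤ ModuleCat.{u} R} (hZ : IsTorsFreeRep D Z)
    (f : Y ⟶ Z) (hf : ∀ v, Function.Injective (f.app v).hom) : IsTorsFreeRep D Y := by
  intro v I x hI hx
  refine hf v ((hZ v I _ hI fun r hr => ?_).trans (map_zero _).symm)
  rw [← map_smul, hx r hr, map_zero]

/-- The saturation of the subrepresentation generated by an element. -/
noncomputable def IsGabrielTopology.hull (hD : IsGabrielTopology D) (Y : J ⥤ ModuleCat.{u} R)
    {v : J} (d : Y.obj v) : SubRep Y where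
  carrier w := hD.saturation (LinearMap.range (pathComb Y d w))
  map_mem w w' p x hx := by
    obtain ⟨I, hI, h⟩ := hD.mem_saturation.1 hx
    refine hD.mem_saturation.2 ⟨I, hI, fun r hr => ?_⟩
    obtain ⟨c, hc⟩ := h r hr
    exact ⟨_, by rw [← map_smul, ← hc, map_pathComb]⟩

theorem IsGabrielTopology.mem_hull (hD : IsGabrielTopology D) {Y : J ⥤ ModuleCat.{u} R}
    {v w : J} {d : Y.obj v} {x : Y.obj w} :
    x ∈ (hD.hull Y d).carrier w ↔ ∃ I, D I ∧ ∀ r ∈ I, ∃ c, pathComb Y d w c = r • x :=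
  hD.mem_saturation

theorem IsGabrielTopology.self_mem_hull (hD : IsGabrielTopology D) {Y : J ⥤ ModuleCat.{u} R}
    {v : J} (d : Y.obj v) : d ∈ (hD.hull Y d).carrier v :=
  hD.le_saturation _ ⟨_, pathComb_single_id Y d⟩

theorem IsGabrielTopology.app_mem_hull (hD : IsGabrielTopology D) {Y Z : J ⥤ ModuleCat.{u} R}
    (f : Y ⟶ Z) {v w : J} {d : Y.obj v} {x : Y.obj w} (hx : x ∈ (hD.hull Y d).carrier w) :
    (f.app w).hom x ∈ (hD.hull Z ((f.app v).hom d)).carrier w := by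
  obtain ⟨I, hI, h⟩ := hD.mem_hull.1 hx
  refine hD.mem_hull.2 ⟨I, hI, fun r hr => ?_⟩
  obtain ⟨c, hc⟩ := h r hr
  exact ⟨c, by rw [← pathComb_app, hc, map_smul]⟩

/-- A morphism is reduced if its kernel contains no nonzero saturated subrepresentation. -/
def IsGabrielTopology.IsReduced (hD : IsGabrielTopology D) {Y X : J ⥤ ModuleCat.{u} R}
    (φ : Y ⟶ X) : Prop :=
  ∀ ⦃v : J⦄ (d : Y.obj v),
    (∀ (w : J), ∀ x ∈ (hD.hull Y d).carrier w, (φ.app w).hom x = 0) → d = 0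

/-- A morphism over `X` from a reduced object to a torsion free object is injective. -/
theorem IsGabrielTopology.IsReduced.injective {hD : IsGabrielTopology D}
    {Y Z X : J ⥤ ModuleCat.{u} R} {φ : Y ⟶ X} (hφ : hD.IsReduced φ) (hZ : IsTorsFreeRep D Z)
    {ζ : Z ⟶ X} (f : Y ⟶ Z) (hf : f ≫ ζ = φ) (v : J) : Function.Injective (f.app v).hom := by
  rw [injective_iff_map_eq_zero]
  intro d hd
  -- `f` kills `d`, hence the subrepresentation it generates, hence its whole hull because `Z` is
  -- torsion free.
  refine hφ d fun w x hx => ?_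
  obtain ⟨I, hI, h⟩ := hD.mem_hull.1 hx
  have : (f.app w).hom x = 0 := hZ w I _ hI fun r hr => by
    obtain ⟨c, hc⟩ := h r hr
    rw [← map_smul, ← hc, pathComb_app, hd]
    simp [pathComb, Finsupp.linearCombination_apply]
  subst hf
  change (ζ.app w).hom ((f.app w).hom x) = 0
  rw [this, map_zero]

/-- A subrepresentation is saturated if it is so at every vertex. -/
def SubRep.IsSaturated (D : Submodule R R → Prop) {Y : J ⥤ ModuleCat.{u} R} (K : SubRep Y) :
    Prop :=
  ∀ (v : J) (I : Submodule R R) (x : Y.obj v), D I → (∀ r ∈ I, r • x ∈ K.carrier v) →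
    x ∈ K.carrier v

/-- Finite type enters here: the finitely many generators of a dense ideal multiply `x` into a
single member of the chain, which is saturated and so contains `x`. -/
theorem SubRep.isSaturated_chainUnion (hfin : IsFiniteTypeTopology D)
    {Y : J ⥤ ModuleCat.{u} R} {c : Set (SubRep Y)} {hc : IsChain (· ≤ ·) c} {hne : c.Nonempty}
    (h : ∀ N ∈ c, N.IsSaturated D) : (SubRep.chainUnion c hc hne).IsSaturated D := by
  classical
  intro v I x hI hx
  obtain ⟨I', hI'I, ⟨s, rfl⟩, hI'⟩ := hfin I hI
  have hs : ∃ N ∈ c, ∀ r ∈ s, r • x ∈ N.carrier v := by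
    have hsI : ∀ r ∈ s, r ∈ I := fun r hr => hI'I (Submodule.subset_span hr)
    clear hI' hI'I
    induction s using Finset.induction_on with
    | empty => exact ⟨_, hne.choose_spec, by simp⟩
    | insert a s _ ih =>
      obtain ⟨N, hN, hNs⟩ := ih fun r hr => hsI r (Finset.mem_insert_of_mem hr)
      obtain ⟨M, hM, hMa⟩ := hx a (hsI a (Finset.mem_insert_self _ _))
      obtain ⟨P, hP, hNP, hMP⟩ : ∃ P ∈ c, N ≤ P ∧ M ≤ P := by
        rcases hc.total hN hM with hle | hle
        · exact ⟨M, hM, hle, le_rfl⟩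
        · exact ⟨N, hN, le_rfl, hle⟩
      refine ⟨P, hP, fun r hr => ?_⟩
      rcases Finset.mem_insert.1 hr with rfl | hr
      · exact SubRep.mem_of_le hMP hMa
      · exact SubRep.mem_of_le hNP (hNs r hr)
  obtain ⟨N, hN, hNs⟩ := hs
  refine ⟨N, hN, h N hN v _ x hI' fun r hr => ?_⟩
  have : Submodule.span R (s : Set R) ≤
      (N.carrier v).comap (LinearMap.toSpanSingleton R (Y.obj v) x) :=
    Submodule.span_le.2 hNs
  exact this hr

/-- If `φ` kills the hull of `q d`, the preimage of this hull in `Y` is saturated and lies between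
the kernels of `q` and `q ≫ φ`. By maximality it is the kernel of `q`, so `q d = 0`. -/
theorem IsGabrielTopology.IsReduced.of_maximal {hD : IsGabrielTopology D}
    {Y Z X : J ⥤ ModuleCat.{u} R} (q : Y ⟶ Z) (hq : ∀ v, Function.Surjective (q.app v).hom)
    (φ : Z ⟶ X)
    (h : ∀ K : SubRep Y, K.IsSaturated D → K ≤ SubRep.ker (q ≫ φ) → SubRep.ker q ≤ K →
      K ≤ SubRep.ker q) : hD.IsReduced φ := by
  intro v d hd
  obtain ⟨d, rfl⟩ := hq v d
  refine h (SubRep.comap q (hD.hull Z ((q.app v).hom d))) ?_ ?_ ?_ v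
    (SubRep.mem_comap.2 (hD.self_mem_hull ((q.app v).hom d)))
  · intro w I x hI hx
    refine SubRep.mem_comap.2 (hD.saturation_saturated hI fun r hr => ?_)
    have := SubRep.mem_comap.1 (hx r hr)
    rwa [map_smul] at this
  · exact fun w x hx => hd w _ (SubRep.mem_comap.1 hx)
  · intro w x hx
    rw [SubRep.mem_comap, SubRep.mem_ker.1 hx]
    exact zero_mem _

/-- Over a Gabriel topology of finite type, every morphism from a torsion free representation
factors through a reduced morphism from a torsion free representation. -/
theorem IsGabrielTopology.exists_reduced_factorization (hD : IsGabrielTopology D)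
    (hfin : IsFiniteTypeTopology D) {Y X : J ⥤ ModuleCat.{u} R} (hY : IsTorsFreeRep D Y)
    (φ : Y ⟶ X) :
    ∃ (Y' : J ⥤ ModuleCat.{u} R) (q : Y ⟶ Y') (φ' : Y' ⟶ X),
      q ≫ φ' = φ ∧ IsTorsFreeRep D Y' ∧ hD.IsReduced φ' := by
  let S : Set (SubRep Y) := {K | (∀ v x, x ∈ K.carrier v → (φ.app v).hom x = 0) ∧
    K.IsSaturated D}
  obtain ⟨K, -, hK⟩ := zorn_le_nonempty₀ S (fun c hcS hc y hy => by
    refine ⟨SubRep.chainUnion c hc ⟨y, hy⟩, ⟨?_, ?_⟩, fun z hz => SubRep.le_chainUnion hz⟩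
    · rintro v x ⟨N, hN, hx⟩
      exact (hcS hN).1 v x hx
    · exact SubRep.isSaturated_chainUnion hfin fun N hN => (hcS hN).2) (⊥ : SubRep Y)
    ⟨fun v x hx => by rw [SubRep.mem_bot.1 hx, map_zero],
      fun v I x hI hx => SubRep.mem_bot.2 (hY v I x hI fun r hr => SubRep.mem_bot.1 (hx r hr))⟩
  obtain ⟨φ', hφ'⟩ := exists_desc_of_surjective K.π K.π_surjective φ
    fun v x hx => hK.prop.1 v x (K.π_eq_zero.1 hx)
  refine ⟨K.quotient, K.π, φ', hφ', fun v => isTorsFree_quotient (hK.prop.2 v), ?_⟩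
  refine IsReduced.of_maximal K.π K.π_surjective φ' fun K' h1 h2 h3 => ?_
  refine le_trans (hK.2 ⟨?_, h1⟩ ?_) fun v x hx => SubRep.mem_ker.2 (K.π_eq_zero.2 hx)
  · rw [← hφ']
    exact h2
  · exact le_trans (fun v x hx => SubRep.mem_ker.2 (K.π_eq_zero.2 hx)) h3

/-- A type of colours for the elements at `v` of the representations reduced over `X`. -/
abbrev ReducedBound (X : J ⥤ ModuleCat.{u} R) (v : J) : Type u :=
  ∀ t : Σ w : J, Submodule R R × (R → ((v ⟶ w) →₀ R)), X.obj t.1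

/-- Torsion free representations which are reduced over `X` are bounded in terms of `X`. -/
theorem IsGabrielTopology.IsReduced.exists_embedding {hD : IsGabrielTopology D}
    {Y X : J ⥤ ModuleCat.{u} R} (hY : IsTorsFreeRep D Y) {φ : Y ⟶ X} (hφ : hD.IsReduced φ)
    (v : J) : ∃ f : Y.obj v → ReducedBound X v, Function.Injective f := by
  classical
  -- A solution `x` of this system is what a hull element of `y - y'` looks like, `t` recording its
  -- vertex, an ideal and the coefficients. The colour of `y` at `t` is the `φ`-image of a solution
  -- comparing `y` with the representative of its class.
  let rel (t : Σ w : J, Submodule R R × (R → ((v ⟶ w) →₀ R))) (y y' : Y.obj v)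
      (x : Y.obj t.1) : Prop :=
    ∀ r ∈ t.2.1, r • x = pathComb Y y t.1 (t.2.2 r) - pathComb Y y' t.1 (t.2.2 r)
  let s (t : Σ w : J, Submodule R R × (R → ((v ⟶ w) →₀ R))) : Setoid (Y.obj v) :=
    { r := fun y y' => ∃ x, rel t y y' x
      iseqv :=
        { refl := fun y => ⟨0, fun r _ => by simp⟩
          symm := by
            rintro y y' ⟨x, hx⟩
            exact ⟨-x, fun r hr => by rw [smul_neg, hx r hr, neg_sub]⟩
          trans := by
            rintro y y' y'' ⟨x, hx⟩ ⟨x', hx'⟩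
            exact ⟨x + x', fun r hr => by rw [smul_add, hx r hr, hx' r hr, sub_add_sub_cancel]⟩ } }
  have hrep : ∀ t y, ∃ x, rel t y (Quotient.mk (s t) y).out x := fun t y =>
    (s t).symm (Quotient.exact (Quotient.mk (s t) y).out_eq)
  choose ξ hξ using hrep
  refine ⟨fun y t => (φ.app t.1).hom (ξ t y), fun y y' h => sub_eq_zero.1 (hφ _ ?_)⟩
  intro w x hx
  obtain ⟨I, hI, hx⟩ := hD.mem_hull.1 hx
  have hx' : ∀ r, ∃ c, r ∈ I → pathComb Y (y - y') w c = r • x := fun r => by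
    by_cases hr : r ∈ I
    · obtain ⟨c, hc⟩ := hx r hr
      exact ⟨c, fun _ => hc⟩
    · exact ⟨0, fun h => absurd h hr⟩
  choose g hg using hx'
  let t : Σ w : J, Submodule R R × (R → ((v ⟶ w) →₀ R)) := ⟨w, I, g⟩
  have hyy' : Quotient.mk (s t) y = Quotient.mk (s t) y' :=
    Quotient.sound ⟨x, fun r hr => by rw [← hg r hr, pathComb_sub]⟩
  -- Both `x` and `ξ t y - ξ t y'` solve the same system over the dense ideal `I`. Solutions are
  -- unique since `Y` is torsion free, so equal colours give `φ x = 0`.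
  have hx0 : x - (ξ t y - ξ t y') = 0 := by
    refine hY w I _ hI fun r hr => ?_
    have h1 := hξ t y r hr
    have h2 := hξ t y' r hr
    rw [← hyy'] at h2
    have h3 : r • x = pathComb Y y w (g r) - pathComb Y y' w (g r) := by
      rw [← hg r hr, pathComb_sub]
    rw [smul_sub, smul_sub, h1, h2, h3, sub_sub_sub_cancel_right, sub_self]
  rw [sub_eq_zero.1 hx0, map_sub, sub_eq_zero]
  exact congrFun h t

end ModuleRepresentations

/-! ### Torsion free precovers. -/

section Precovers

variable {R : Type u} [Ring R] {J : Type u} [SmallCategory J] {D : Submodule R R → Prop}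

/-- The free representation on families of elements at the vertices. -/
noncomputable def freeRep (B : J → Type u) : J ⥤ ModuleCat.{u} R where
  obj w := ModuleCat.of R ((Σ v, B v × (v ⟶ w)) →₀ R)
  map p := ModuleCat.ofHom (Finsupp.lmapDomain R R fun a => ⟨a.1, a.2.1, a.2.2 ≫ p⟩)
  map_id w := by
    refine ModuleCat.hom_ext (Finsupp.lhom_ext fun a r => ?_)
    simp [Finsupp.mapDomain_single]
  map_comp p q := by
    refine ModuleCat.hom_ext (Finsupp.lhom_ext fun a r => ?_)
    simp [Finsupp.mapDomain_single]

/-- Families of elements at the vertices extend to the free representation on them. -/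
theorem exists_freeRep_desc {B : J → Type u} (Y : J ⥤ ModuleCat.{u} R)
    (f : ∀ v, B v → Y.obj v) (hf : ∀ v, Function.Surjective (f v)) :
    ∃ e : freeRep B ⟶ Y, ∀ v, Function.Surjective (e.app v).hom := by
  refine ⟨{ app := fun w => ModuleCat.ofHom (Finsupp.linearCombination R
              fun a : Σ v, B v × (v ⟶ w) => (Y.map a.2.2).hom (f a.1 a.2.1))
            naturality := fun w w' p => ?_ }, fun v y => ?_⟩
  · refine ModuleCat.hom_ext (Finsupp.lhom_ext' fun a => LinearMap.ext_ring ?_)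
    simp [freeRep, Finsupp.mapDomain_single]
  · obtain ⟨b, rfl⟩ := hf v y
    exact ⟨Finsupp.single ⟨v, b, 𝟙 v⟩ 1, (Finsupp.linearCombination_single R _ _).trans (by simp)⟩

/-- The direct sum of a family of representations. -/
noncomputable def sumRep {ι : Type u} (W : ι → J ⥤ ModuleCat.{u} R) : J ⥤ ModuleCat.{u} R where
  obj w := ModuleCat.of R (⨁ i, (W i).obj w)
  map p := ModuleCat.ofHom (DirectSum.lmap fun i => ((W i).map p).hom)
  map_id w := by
    ext x : 2
    simp
  map_comp p q := by
    ext x : 2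
    simp [DirectSum.lmap_comp]

/-- A family of morphisms factors through its direct sum. -/
theorem exists_sumRep_desc {ι : Type u} (W : ι → J ⥤ ModuleCat.{u} R) {X : J ⥤ ModuleCat.{u} R}
    (φ : ∀ i, W i ⟶ X) : ∃ ψ : sumRep W ⟶ X, ∀ i, ∃ f : W i ⟶ sumRep W, f ≫ ψ = φ i := by
  classical
  refine ⟨{ app := fun w => ModuleCat.ofHom (DirectSum.toModule R ι _ fun i => ((φ i).app w).hom)
            naturality := fun v w p => ?_ }, fun i =>
      ⟨{ app := fun w => ModuleCat.ofHom (DirectSum.lof R ι (fun i => (W i).obj w) i)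
         naturality := fun v w p => ?_ }, ?_⟩⟩
  · refine ModuleCat.hom_ext (DirectSum.linearMap_ext R fun i => LinearMap.ext fun x => ?_)
    simp [sumRep]
  · ext x
    exact (DirectSum.lmap_lof (fun i => ((W i).map p).hom) i x).symm
  · ext w x
    exact DirectSum.toModule_lof (M := fun i => (W i).obj w) (N := X.obj w)
      (φ := fun i => ((φ i).app w).hom) R i x

theorem isTorsFreeRep_sumRep {ι : Type u} {W : ι → J ⥤ ModuleCat.{u} R}
    (hW : ∀ i, IsTorsFreeRep D (W i)) : IsTorsFreeRep D (sumRep W) := by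
  intro v I x hI hx
  refine DFinsupp.ext (β := fun i => (W i).obj v) fun i => hW i v I _ hI fun r hr => ?_
  exact DFunLike.congr_fun (F := Π₀ i, (W i).obj v) (hx r hr) i

/-- Every representation has a torsion free precover, which can be chosen to be reduced. -/
theorem IsGabrielTopology.exists_reduced_precover (hD : IsGabrielTopology D)
    (hfin : IsFiniteTypeTopology D) (X : J ⥤ ModuleCat.{u} R) :
    ∃ (W : J ⥤ ModuleCat.{u} R) (ψ : W ⟶ X), IsTorsFreeRep D W ∧ hD.IsReduced ψ ∧
      ∀ (Y : J ⥤ ModuleCat.{u} R) (φ : Y ⟶ X), IsTorsFreeRep D Y → ∃ f : Y ⟶ W, f ≫ ψ = φ := by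
  let G : J ⥤ ModuleCat.{u} R := freeRep (ReducedBound X)
  -- This index type is small, and every reduced torsion free object over `X` occurs in it: its
  -- elements inject into the colours, so it is a quotient of `G`.
  let ι : Type u := Σ N : {N : SubRep G // IsTorsFreeRep D N.quotient}, N.1.quotient ⟶ X
  obtain ⟨ψ, hψ⟩ := exists_sumRep_desc (fun i : ι => i.1.1.quotient) fun i => i.2
  obtain ⟨W, q, ψ', hq, hW, hred⟩ := hD.exists_reduced_factorization hfin
    (isTorsFreeRep_sumRep fun i : ι => i.1.2) ψ
  refine ⟨W, ψ', hW, hred, fun Y φ hY => ?_⟩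
  obtain ⟨Y', p, φ', hp, hY', hred'⟩ := hD.exists_reduced_factorization hfin hY φ
  choose c hc using hred'.exists_embedding hY'
  obtain ⟨e, he⟩ := exists_freeRep_desc Y' (fun v => Function.invFun (c v))
    fun v => Function.invFun_surjective (hc v)
  let N : SubRep G := SubRep.ker e
  have hNe : ∀ v (x : G.obj v), (N.π.app v).hom x = 0 ↔ (e.app v).hom x = 0 :=
    fun v x => N.π_eq_zero.trans SubRep.mem_ker
  obtain ⟨g, hg⟩ := exists_desc_of_surjective e he N.π fun v x h => (hNe v x).2 h
  obtain ⟨g', hg'⟩ := exists_desc_of_surjective N.π N.π_surjective e fun v x h => (hNe v x).1 h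
  have : Epi e := by
    have := fun v => (ModuleCat.epi_iff_surjective (e.app v)).2 (he v)
    exact NatTrans.epi_of_epi_app e
  have hgg' : g ≫ g' = 𝟙 Y' := by
    rw [← cancel_epi e, ← Category.assoc, hg, hg', Category.comp_id]
  have hNtf : IsTorsFreeRep D N.quotient := by
    refine hY'.of_injective g' fun v => ?_
    rw [injective_iff_map_eq_zero]
    intro x hx
    obtain ⟨x, rfl⟩ := N.π_surjective v x
    rw [hNe, ← hg']
    exact hx
  obtain ⟨f, hf⟩ := hψ ⟨⟨N, hNtf⟩, g' ≫ φ'⟩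
  refine ⟨p ≫ g ≫ f ≫ q, ?_⟩
  simp only [Category.assoc, hq, hf, hp, reassoc_of% hgg']

end Precovers

/-! ### Enough injective representations. -/

section Injectives

variable {R : Type u} [Ring R] {J : Type u} [SmallCategory J]

theorem mono_of_injective_app {Y Z : J ⥤ ModuleCat.{u} R} (f : Y ⟶ Z)
    (hf : ∀ v, Function.Injective (f.app v).hom) : Mono f := by
  have := fun v => (ModuleCat.mono_iff_injective (f.app v)).2 (hf v)
  exact NatTrans.mono_of_mono_app f

theorem injective_app_of_mono {Y Z : J ⥤ ModuleCat.{u} R} (f : Y ⟶ Z) [Mono f] (v : J) :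
    Function.Injective (f.app v).hom :=
  (ModuleCat.mono_iff_injective (f.app v)).1 ((NatTrans.mono_iff_mono_app f).1 inferInstance v)

/-- Evaluation at `v` preserves monomorphisms, so its right adjoint preserves injectives. `Y` embeds
in the product of the images of injective modules containing the `Y(v)`. -/
theorem exists_mono_injective_rep (Y : J ⥤ ModuleCat.{u} R) :
    ∃ (E : J ⥤ ModuleCat.{u} R) (i : Y ⟶ E), Injective E ∧ Mono i := by
  let adj := fun v : J => evaluationAdjunctionLeft (ModuleCat.{u} R) v
  let E : J → J ⥤ ModuleCat.{u} R := fun v =>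
    (evaluationRightAdjoint (ModuleCat.{u} R) v).obj (Injective.under (Y.obj v))
  have hE : ∀ v, Injective (E v) := fun v => (adj v).map_injective _ (Injective.injective_under _)
  let i : ∀ v, Y ⟶ E v := fun v => (adj v).homEquiv _ _ (Injective.ι (Y.obj v))
  refine ⟨∏ᶜ E, Limits.Pi.lift i, inferInstance, ⟨fun {Z} g h hgh => ?_⟩⟩
  ext1
  funext v
  have h1 : g ≫ i v = h ≫ i v := by
    simpa using congrArg (· ≫ Limits.Pi.π E v) hgh
  rw [← cancel_mono (Injective.ι (Y.obj v))]
  rw [← (adj v).homEquiv_naturality_left, ← (adj v).homEquiv_naturality_left] at h1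
  exact ((adj v).homEquiv _ _).injective h1

end Injectives

/-! ### Maximal reduced subobjects and covers. -/

section MaximalReduced

variable {R : Type u} [Ring R] {J : Type u} [SmallCategory J] {D : Submodule R R → Prop}

/-- The product of two representations. -/
def prodRep (A B : J ⥤ ModuleCat.{u} R) : J ⥤ ModuleCat.{u} R where
  obj v := ModuleCat.of R (A.obj v × B.obj v)
  map p := ModuleCat.ofHom ((A.map p).hom.prodMap (B.map p).hom)
  map_id v := by ext x <;> simp
  map_comp p q := by ext x <;> simp

namespace prodRep

variable {A B Z : J ⥤ ModuleCat.{u} R}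

/-- The first projection. -/
def fst (A B : J ⥤ ModuleCat.{u} R) : prodRep A B ⟶ A where
  app v := ModuleCat.ofHom (LinearMap.fst R (A.obj v) (B.obj v))

/-- The second projection. -/
def snd (A B : J ⥤ ModuleCat.{u} R) : prodRep A B ⟶ B where
  app v := ModuleCat.ofHom (LinearMap.snd R (A.obj v) (B.obj v))

/-- The morphism to the product with given components. -/
def lift (f : Z ⟶ A) (g : Z ⟶ B) : Z ⟶ prodRep A B where
  app v := ModuleCat.ofHom ((f.app v).hom.prod (g.app v).hom)
  naturality v w p := by
    ext x
    exact Prod.ext (NatTrans.naturality_apply f p x) (NatTrans.naturality_apply g p x)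

theorem lift_comp_fst_snd (f : Z ⟶ prodRep A B) : lift (f ≫ fst A B) (f ≫ snd A B) = f := rfl

/-- The morphism from the product with given restrictions to the factors. -/
def desc (f : A ⟶ Z) (g : B ⟶ Z) : prodRep A B ⟶ Z := fst A B ≫ f + snd A B ≫ g

theorem lift_desc {Y : J ⥤ ModuleCat.{u} R} (f : A ⟶ Z) (g : B ⟶ Z) (a : Y ⟶ A) (b : Y ⟶ B) :
    lift a b ≫ desc f g = a ≫ f + b ≫ g := rfl

theorem mono_desc (f : A ⟶ Z) (g : B ⟶ Z)
    (h : ∀ v a b, (f.app v).hom a + (g.app v).hom b = 0 → a = 0 ∧ b = 0) : Mono (desc f g) := by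
  refine mono_of_injective_app _ fun v => (injective_iff_map_eq_zero _).2 ?_
  rintro ⟨a, b⟩ hab
  obtain ⟨rfl, rfl⟩ := h v a b hab
  rfl

/-- Morphisms to an injective object from two independent subobjects have a common extension. -/
theorem exists_extension {E : J ⥤ ModuleCat.{u} R} [Injective E] (f : A ⟶ Z) (g : B ⟶ Z)
    (h : ∀ v a b, (f.app v).hom a + (g.app v).hom b = 0 → a = 0 ∧ b = 0) (a : A ⟶ E)
    (b : B ⟶ E) : ∃ k : Z ⟶ E, f ≫ k = a ∧ g ≫ k = b := by
  have := mono_desc f g h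
  obtain ⟨k, hk⟩ := Injective.factors (desc a b) (desc f g)
  refine ⟨k, ?_, ?_⟩
  · have := congrArg (lift (𝟙 A) 0 ≫ ·) hk
    simpa [← Category.assoc, lift_desc] using this
  · have := congrArg (lift 0 (𝟙 B) ≫ ·) hk
    simpa [← Category.assoc, lift_desc] using this

end prodRep

/-- Torsion freeness and reducedness can be checked on subobjects covering all elements. -/
theorem IsGabrielTopology.isReduced_of_cover {hD : IsGabrielTopology D}
    {Z X : J ⥤ ModuleCat.{u} R} (φ : Z ⟶ X)
    (h : ∀ v (d : Z.obj v), ∃ (N : J ⥤ ModuleCat.{u} R) (e : N ⟶ Z),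
      (∀ v, Function.Injective (e.app v).hom) ∧ IsTorsFreeRep D N ∧ hD.IsReduced (e ≫ φ) ∧
        ∃ d', (e.app v).hom d' = d) : IsTorsFreeRep D Z ∧ hD.IsReduced φ := by
  constructor
  · intro v I d hI hd
    obtain ⟨N, e, he, hN, -, d, rfl⟩ := h v d
    rw [hN v I d hI fun r hr => he v (by rw [map_smul, hd r hr, map_zero]), map_zero]
  · intro v d hd
    obtain ⟨N, e, he, -, hN, d, rfl⟩ := h v d
    rw [hN d fun w x hx => hd w _ (hD.app_mem_hull e hx), map_zero]

/-- The subrepresentations of `I × X` which are graphs of reduced morphisms to `X` from torsion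
free subrepresentations of `I`. -/
def IsGabrielTopology.reducedGraphs (hD : IsGabrielTopology D) (I X : J ⥤ ModuleCat.{u} R) :
    Set (SubRep (prodRep I X)) :=
  {Z | (∀ v, Function.Injective ((Z.ι ≫ prodRep.fst I X).app v).hom) ∧
    IsTorsFreeRep D Z.toRep ∧ hD.IsReduced (Z.ι ≫ prodRep.snd I X)}

theorem IsGabrielTopology.range_mem_reducedGraphs {hD : IsGabrielTopology D}
    {Z I X : J ⥤ ModuleCat.{u} R} (i : Z ⟶ I) (φ : Z ⟶ X)
    (hi : ∀ v, Function.Injective (i.app v).hom) (hZ : IsTorsFreeRep D Z) (hφ : hD.IsReduced φ) :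
    SubRep.range (prodRep.lift i φ) ∈ hD.reducedGraphs I X := by
  let N := SubRep.range (prodRep.lift i φ)
  let e : Z ⟶ N.toRep := N.lift (prodRep.lift i φ) fun v x => ⟨x, rfl⟩
  have hesurj : ∀ v (d : N.toRep.obj v), ∃ d', (e.app v).hom d' = d := by
    rintro v ⟨_, d, rfl⟩
    exact ⟨d, rfl⟩
  have hei : ∀ v, Function.Injective (e.app v).hom := fun v x y hxy =>
    hi v (congrArg ((N.ι ≫ prodRep.fst I X).app v).hom hxy)
  refine ⟨fun v a b hab => ?_, hD.isReduced_of_cover _ fun v d =>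
    ⟨Z, e, hei, hZ, hφ, hesurj v d⟩⟩
  obtain ⟨a, rfl⟩ := hesurj v a
  obtain ⟨b, rfl⟩ := hesurj v b
  exact congrArg _ (hi v hab)

/-- Each element of the union lies in a member of the chain, and all three conditions can be tested
there. -/
theorem IsGabrielTopology.chainUnion_mem_reducedGraphs {hD : IsGabrielTopology D}
    {I X : J ⥤ ModuleCat.{u} R} {c : Set (SubRep (prodRep I X))} (hc : IsChain (· ≤ ·) c)
    (hne : c.Nonempty) (h : c ⊆ hD.reducedGraphs I X) :
    SubRep.chainUnion c hc hne ∈ hD.reducedGraphs I X := by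
  let Z := SubRep.chainUnion c hc hne
  refine ⟨fun v => ?_, hD.isReduced_of_cover _ fun v d => ?_⟩
  · rw [injective_iff_map_eq_zero]
    rintro ⟨a, N, hN, ha⟩ h0
    have h1 : (⟨a, ha⟩ : N.toRep.obj v) = 0 :=
      (injective_iff_map_eq_zero _).1 ((h hN).1 v) ⟨a, ha⟩ h0
    exact Z.ι_injective v (congrArg (N.ι.app v).hom h1)
  · obtain ⟨d, N, hN, hd⟩ := d
    exact ⟨N.toRep, Z.lift N.ι fun v x => ⟨N, hN, x.2⟩, fun v x y hxy =>
      N.ι_injective v (congrArg (Z.ι.app v).hom hxy), (h hN).2.1, (h hN).2.2, ⟨d, hd⟩, rfl⟩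

/-- A small representation misses one of many independent subrepresentations. -/
theorem exists_disjoint_summand {Z Y E I : J ⥤ ModuleCat.{u} R} (z : Z ⟶ I)
    (f : Z ⟶ Y) (hf : ∀ v, Function.Injective (f.app v).hom)
    (i : Set (Σ v, Y.obj v) → (E ⟶ I)) (p : Set (Σ v, Y.obj v) → (I ⟶ E))
    (hip : ∀ s, i s ≫ p s = 𝟙 E) (hip' : ∀ s t, s ≠ t → i s ≫ p t = 0) :
    ∃ s, ∀ v (x : Z.obj v) (y : E.obj v), (z.app v).hom x = ((i s).app v).hom y → y = 0 := by
  -- Otherwise each copy `s` of `E` shares a nonzero element with `Z`, given by some `x s`. Since `p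
  -- s` kills the other copies, `s ↦ f (x s)` would inject the power set of the elements of `Y` into
  -- these elements.
  by_contra! hcon
  choose v x y hxy hy using hcon
  refine Function.cantor_injective
    (fun s : Set (Σ v, Y.obj v) => (⟨v s, (f.app _).hom (x s)⟩ : Σ v, Y.obj v)) ?_
  intro s t hst'
  by_contra hst
  have hAB : (⟨v s, (f.app _).hom (x s)⟩ : Σ v, Y.obj v) = ⟨v t, (f.app _).hom (x t)⟩ := hst'
  clear hst'
  have hv : v s = v t := congrArg Sigma.fst hAB
  have key : ∀ (v : J) (x x' : Z.obj v) (y y' : E.obj v), (f.app v).hom x = (f.app v).hom x' →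
      (z.app v).hom x = ((i s).app v).hom y → (z.app v).hom x' = ((i t).app v).hom y' →
      y = 0 := by
    intro v x x' y y' h1 h2 h3
    rw [← hf v h1] at h3
    have h4 := congrArg ((p s).app v).hom (h2.symm.trans h3)
    have h5 : ((i s ≫ p s).app v).hom y = ((i t ≫ p s).app v).hom y' := h4
    rw [hip, hip' t s (Ne.symm hst)] at h5
    exact h5
  have h1 := hxy s
  have h2 := hxy t
  have h3 := hy s
  generalize x s = xs at *
  generalize x t = xt at *
  generalize y s = ys at *
  generalize y t = yt at *
  generalize v s = vs at *
  subst hv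
  exact h3 (key _ xs xt ys yt (eq_of_heq (Sigma.mk.inj hAB).2) h1 h2)

/-- A subobject of an injective object which is independent of an injective `E` into which it
embeds can be re-embedded along any of its injective endomorphisms. -/
theorem exists_mono_extension {Z E I : J ⥤ ModuleCat.{u} R} [Injective E] [Injective I]
    (z : Z ⟶ I) (hz : ∀ v, Function.Injective (z.app v).hom) (g : Z ⟶ E)
    (hg : ∀ v, Function.Injective (g.app v).hom) (i : E ⟶ I)
    (hzi : ∀ v (x : Z.obj v) (y : E.obj v), (z.app v).hom x = (i.app v).hom y → y = 0)
    (f : Z ⟶ Z) (hf : ∀ v, Function.Injective (f.app v).hom) :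
    ∃ k : Z ⟶ I, f ≫ k = z ∧ ∀ v, Function.Injective (k.app v).hom := by
  obtain ⟨r, hzr, hir⟩ := prodRep.exists_extension (E := E) z i (fun v a b hab => by
    have hb : b = 0 := by
      rw [← neg_eq_zero]
      exact hzi v a _ (by rw [map_neg]; exact eq_neg_of_add_eq_zero_left hab)
    refine ⟨hz v ?_, hb⟩
    rw [map_zero, ← hab, hb, map_zero, add_zero]) 0 (𝟙 E)
  have := mono_of_injective_app f hf
  obtain ⟨a, ha⟩ := Injective.factors z f
  -- Removing the component along `E` leaves the extension property intact, because `r` vanishes on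
  -- `Z`, and frees this copy of `E` to repair the kernel of `a'`.
  let a' : Z ⟶ I := a - a ≫ r ≫ i
  have ha' : f ≫ a' = z := by
    simp only [a', Preadditive.comp_sub, reassoc_of% ha, ha, reassoc_of% hzr, Limits.zero_comp,
      sub_zero]
  have har : a' ≫ r = 0 := by
    simp [a', Preadditive.sub_comp, hir]
  let K := SubRep.ker a'
  -- The image of `f` meets the kernel `K` trivially since `f ≫ a' = z` is injective. So `j` may
  -- vanish on that image and embed `K` into `E`.
  obtain ⟨j, hfj, hKj⟩ := prodRep.exists_extension (E := E) f K.ι (fun v x y hxy => by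
    have h1 : ((f ≫ a').app v).hom x = 0 := by
      have h2 := congrArg (a'.app v).hom hxy
      rw [map_add, map_zero, SubRep.mem_ker.1 (K.ι_mem y), add_zero] at h2
      exact h2
    rw [ha'] at h1
    have hx : x = 0 := hz v (h1.trans (map_zero _).symm)
    refine ⟨hx, K.ι_injective v ?_⟩
    rw [map_zero, ← hxy, hx, map_zero, zero_add]) 0 (K.ι ≫ g)
  refine ⟨a' + j ≫ i, ?_, fun v => (injective_iff_map_eq_zero _).2 fun x hx => ?_⟩
  · rw [Preadditive.comp_add, ha', reassoc_of% hfj, Limits.zero_comp, add_zero]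
  · have hjr : (a' + j ≫ i) ≫ r = j := by
      rw [Preadditive.add_comp, har, Category.assoc, hir, Category.comp_id, zero_add]
    have hjx : (j.app v).hom x = 0 := by
      rw [← hjr]
      exact (congrArg (r.app v).hom hx).trans (map_zero _)
    have hax : (a'.app v).hom x = 0 := by
      have h1 : (a'.app v).hom x + (i.app v).hom ((j.app v).hom x) = 0 := hx
      rwa [hjx, map_zero, add_zero] at h1
    obtain ⟨y, rfl⟩ := K.exists_ι_eq (SubRep.mem_ker.2 hax)
    have h2 : ((K.ι ≫ j).app v).hom y = 0 := hjx
    rw [hKj] at h2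
    exact hg v (h2.trans (map_zero _).symm)

/-- Over a Gabriel topology of finite type, every representation has a torsion free cover. -/
theorem IsGabrielTopology.exists_torsFree_cover (hD : IsGabrielTopology D)
    (hfin : IsFiniteTypeTopology D) (X : J ⥤ ModuleCat.{u} R) :
    ∃ (Z : J ⥤ ModuleCat.{u} R) (ψ : Z ⟶ X), IsCover (IsTorsFreeRep D) ψ := by
  classical
  obtain ⟨Y, φ, hY, hφ, hpre⟩ := hD.exists_reduced_precover hfin X
  obtain ⟨E, i, hE, hi⟩ := exists_mono_injective_rep Y
  let S := Set (Σ v, Y.obj v)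
  let I : J ⥤ ModuleCat.{u} R := ∏ᶜ fun _ : S => E
  let inc : S → (E ⟶ I) := fun s => Limits.Pi.lift fun t => if s = t then 𝟙 E else 0
  let pr : S → (I ⟶ E) := fun s => Limits.Pi.π _ s
  have hip : ∀ s, inc s ≫ pr s = 𝟙 E := fun s => by simp [inc, pr]
  have hip' : ∀ s t, s ≠ t → inc s ≫ pr t = 0 := fun s t hst => by simp [inc, pr, hst]
  have hinc : ∀ s, Mono (inc s) := fun s => mono_of_mono_fac (hip s)
  have hI : Injective I := inferInstance
  have hi' : Mono (i ≫ inc ∅) := inferInstance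
  -- Starting from a copy of `Y` makes the maximal `Z` a precover; the index `∅` is arbitrary.
  obtain ⟨Z, hYZ, hZ⟩ := zorn_le_nonempty₀ (hD.reducedGraphs I X)
    (fun c hcS hc y hy => ⟨_, hD.chainUnion_mem_reducedGraphs hc ⟨y, hy⟩ hcS,
      fun z hz => SubRep.le_chainUnion hz⟩) _
    (hD.range_mem_reducedGraphs (i ≫ inc ∅) φ (injective_app_of_mono _) hY hφ)
  let z : Z.toRep ⟶ I := Z.ι ≫ prodRep.fst I X
  let ψ : Z.toRep ⟶ X := Z.ι ≫ prodRep.snd I X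
  obtain ⟨hz, hZtf, hψ⟩ := hZ.prop
  refine ⟨Z.toRep, ψ, ⟨hZtf, fun W hW χ => ?_⟩, fun f hf => ?_⟩
  · obtain ⟨f, hf⟩ := hpre W χ hW
    exact ⟨f ≫ Z.lift (prodRep.lift (i ≫ inc ∅) φ) fun v x => hYZ v ⟨x, rfl⟩, hf⟩
  · have hfi := hψ.injective hZtf f hf
    obtain ⟨g, hg⟩ := hpre _ ψ hZtf
    have hgi := hψ.injective hY g hg
    obtain ⟨s, hs⟩ := exists_disjoint_summand z g hgi inc pr hip hip'
    obtain ⟨k, hfk, hk⟩ := exists_mono_extension z hz (g ≫ i)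
      (fun v => (injective_app_of_mono i v).comp (hgi v)) (inc s) hs f
      hfi
    -- `Z` is the image of `f` followed by the new embedding, so the new graph contains `Z` and by
    -- maximality equals it.
    have hle : Z ≤ SubRep.range (prodRep.lift k ψ) := by
      intro v x hx
      obtain ⟨x, rfl⟩ := Z.exists_ι_eq hx
      have h1 : f ≫ prodRep.lift k ψ = Z.ι := by
        rw [← prodRep.lift_comp_fst_snd Z.ι]
        change prodRep.lift (f ≫ k) (f ≫ ψ) = _
        rw [hfk, hf]
      exact ⟨(f.app v).hom x, congrArg (fun t : Z.toRep ⟶ prodRep I X => (t.app v).hom x) h1⟩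
    have hge := hZ.2 (hD.range_mem_reducedGraphs k ψ hk hZtf hψ) hle
    have hsurj : ∀ v, Function.Surjective (f.app v).hom := by
      intro v x
      obtain ⟨x', hx'⟩ := Z.exists_ι_eq (hge v ⟨x, rfl⟩)
      refine ⟨x', hk v ?_⟩
      have h2 : (z.app v).hom x' = (k.app v).hom x := congrArg Prod.fst hx'
      rw [← h2, ← hfk]
      rfl
    rw [NatTrans.isIso_iff_isIso_app]
    intro v
    exact (ConcreteCategory.isIso_iff_bijective (f.app v)).2 ⟨hfi v, hsurj v⟩

end MaximalReduced

/-! ### From hereditary torsion theories to Gabriel topologies. -/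

section TorsionTheories

variable {R : Type u} [Ring R] {T F : ObjectProperty (ModuleCat.{u} R)}

/-- The left ideals with torsion quotient. -/
def denseIdeals (T : ObjectProperty (ModuleCat.{u} R)) (I : Submodule R R) : Prop :=
  T (ModuleCat.of R (R ⧸ I))

theorem IsTorsionTheory.of_epi (hTF : IsTorsionTheory T F) {X Y : ModuleCat.{u} R} (f : X ⟶ Y)
    [Epi f] (hX : T X) : T Y :=
  hTF.torsion_of fun _ hZ g => by
    rw [← cancel_epi f, hTF.hom_eq_zero hX hZ (f ≫ g), Limits.comp_zero]

theorem IsTorsionTheory.isTorsFree (hTF : IsTorsionTheory T F) {M : ModuleCat.{u} R} (hM : F M) :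
    IsTorsFree (denseIdeals T) M := by
  intro I m hI hm
  let f : (R ⧸ I) →ₗ[R] M := I.liftQ (LinearMap.toSpanSingleton R M m) fun r hr => hm r hr
  have hf : f (Submodule.Quotient.mk 1) = m := (I.liftQ_apply _ 1).trans (one_smul R m)
  have h0 := hTF.hom_eq_zero hI hM (ModuleCat.ofHom f)
  rw [← hf]
  exact congrArg (fun g => g.hom (Submodule.Quotient.mk 1)) h0

theorem IsTorsionTheory.torsion_of_forall (hTF : IsTorsionTheory T F) {M : ModuleCat.{u} R}
    (h : ∀ m : M, ∃ I, denseIdeals T I ∧ ∀ r ∈ I, r • m = 0) : T M := by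
  refine hTF.torsion_of fun Y hY f => ModuleCat.hom_ext (LinearMap.ext fun m => ?_)
  obtain ⟨I, hI, hm⟩ := h m
  exact hTF.isTorsFree hY I _ hI fun r hr => by rw [← map_smul, hm r hr, map_zero]

/-- `R` modulo the annihilator of `m` embeds in `M` as the cyclic submodule `R m`; heredity is used
exactly here. -/
theorem IsHereditaryTorsionTheory.denseIdeals_ker (hTF : IsHereditaryTorsionTheory T F)
    {M : ModuleCat.{u} R} (hM : T M) (m : M) :
    denseIdeals T (LinearMap.ker (LinearMap.toSpanSingleton R M m)) := by
  let f := (LinearMap.ker (LinearMap.toSpanSingleton R M m)).liftQ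
    (LinearMap.toSpanSingleton R M m) le_rfl
  have hf : Function.Injective f := LinearMap.ker_eq_bot.1 (Submodule.ker_liftQ_eq_bot' _ _ rfl)
  have : Mono (ModuleCat.ofHom f) := (ModuleCat.mono_iff_injective _).2 hf
  exact hTF.of_mono (ModuleCat.ofHom f) hM

theorem IsHereditaryTorsionTheory.torsionFree_iff (hTF : IsHereditaryTorsionTheory T F)
    {M : ModuleCat.{u} R} : F M ↔ IsTorsFree (denseIdeals T) M := by
  refine ⟨hTF.toIsTorsionTheory.isTorsFree, fun h => hTF.torsionFree_of fun X hX f =>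
    ModuleCat.hom_ext (LinearMap.ext fun x => ?_)⟩
  refine h _ _ (hTF.denseIdeals_ker hX x) fun r hr => ?_
  have : r • x = 0 := hr
  rw [← map_smul, this, map_zero]

theorem IsHereditaryTorsionTheory.isGabrielTopology (hTF : IsHereditaryTorsionTheory T F) :
    IsGabrielTopology (denseIdeals T) where
  top := hTF.torsion_of fun Y _ f => by
    have : Subsingleton (ModuleCat.of R (R ⧸ (⊤ : Submodule R R))) :=
      inferInstanceAs (Subsingleton (R ⧸ (⊤ : Submodule R R)))
    exact (ModuleCat.isZero_of_subsingleton _).eq_of_src _ _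
  mono I I' h hI := by
    let f := Submodule.factor h
    have : Epi (ModuleCat.ofHom f) :=
      (ModuleCat.epi_iff_surjective _).2 (Submodule.factor_surjective h)
    exact hTF.toIsTorsionTheory.of_epi (ModuleCat.ofHom f) hI
  colon I hI r := by
    -- The ideal `(I : r)` is the annihilator of the class of `r` in `R ⧸ I`.
    have h := hTF.denseIdeals_ker hI (Submodule.Quotient.mk r)
    convert h using 1
    ext s
    change s * r ∈ I ↔ s • (Submodule.Quotient.mk r : R ⧸ I) = 0
    rw [← Submodule.Quotient.mk_smul, Submodule.Quotient.mk_eq_zero, smul_eq_mul]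
  glue I I' hI' h := hTF.torsion_of fun Y hY f => by
    have hYt := hTF.toIsTorsionTheory.isTorsFree hY
    -- For `r` in `I'` the dense ideal `(I : r)` kills `r • f 1`. Torsion freeness of `Y` gives `r •
    -- f 1 = 0`, and applied once more `f 1 = 0`.
    have h1 : f.hom (Submodule.Quotient.mk 1) = 0 := by
      refine hYt I' _ hI' fun r hr => hYt _ _ (h r hr) fun s hs => ?_
      have hs' : s * r ∈ I := hs
      rw [← map_smul, ← map_smul, smul_smul, ← Submodule.Quotient.mk_smul, smul_eq_mul, mul_one,
        (Submodule.Quotient.mk_eq_zero I).2 hs', map_zero]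
    refine ModuleCat.hom_ext (LinearMap.ext fun x => ?_)
    obtain ⟨r, rfl⟩ := Submodule.Quotient.mk_surjective I x
    have h2 : (Submodule.Quotient.mk r : R ⧸ I) = r • Submodule.Quotient.mk 1 := by
      rw [← Submodule.Quotient.mk_smul, smul_eq_mul, mul_one]
    rw [h2, map_smul, h1, smul_zero]
    rfl

theorem IsHereditaryTorsionTheory.isFiniteTypeTopology (hTF : IsHereditaryTorsionTheory T F)
    (hA : DirectSumsInjective F) : IsFiniteTypeTopology (denseIdeals T) :=
  hTF.isGabrielTopology.isFiniteTypeTopology fun ι M hM =>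
    hA ι M fun i => ⟨hTF.torsionFree_iff.2 (hM i).1, (hM i).2⟩

/-- The torsion free class of the componentwise torsion theory is componentwise as well. -/
theorem IsHereditaryTorsionTheory.componentwiseTorsionFree_eq
    (hTF : IsHereditaryTorsionTheory T F) (Q : Type u) [Quiver.{u} Q] :
    componentwiseTorsionFree Q T = IsTorsFreeRep (denseIdeals T) := by
  have hD := hTF.isGabrielTopology
  funext Y
  refine propext ⟨fun hY v => ?_, fun hY X hX f => ?_⟩
  · let t : SubRep Y :=
      { carrier := fun w => hD.saturation ⊥
        map_mem := fun w w' p x hx => by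
          obtain ⟨I, hI, h⟩ := hD.mem_saturation.1 hx
          refine hD.mem_saturation.2 ⟨I, hI, fun r hr => ?_⟩
          rw [← map_smul, (Submodule.mem_bot R).1 (h r hr), map_zero]
          exact zero_mem _ }
    have ht : t.ι = 0 := hY (fun w => hTF.toIsTorsionTheory.torsion_of_forall fun x => by
      obtain ⟨I, hI, h⟩ := hD.mem_saturation.1 x.2
      exact ⟨I, hI, fun r hr => Subtype.ext ((Submodule.mem_bot R).1 (h r hr))⟩) t.ι
    intro I y hI hy
    obtain ⟨x, hx⟩ := t.exists_ι_eq (v := v) (x := y)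
      (hD.mem_saturation.2 ⟨I, hI, fun r hr => by rw [hy r hr]; exact zero_mem _⟩)
    rw [← hx, ht]
    rfl
  · ext v x
    refine hY v _ _ (hTF.denseIdeals_ker (hX v) x) fun r hr => ?_
    have : r • x = 0 := hr
    rw [← map_smul, this, map_zero]

end TorsionTheories

/-- Lifts in both directions compose to automorphisms, so each is a split monomorphism and an
epimorphism. -/
theorem IsCover.exists_iso {C : Type*} [Category C] {F : ObjectProperty C} {X X' X'' : C}
    {ψ : X' ⟶ X} {ψ' : X'' ⟶ X} (h : IsCover F ψ) (h' : IsCover F ψ') :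
    ∃ e : X' ≅ X'', e.hom ≫ ψ' = ψ := by
  obtain ⟨f, hf⟩ := h'.exists_lift h.mem ψ
  obtain ⟨g, hg⟩ := h.exists_lift h'.mem ψ'
  have h1 : IsIso (f ≫ g) := h.isIso_of_comp_eq _ (by rw [Category.assoc, hg, hf])
  have h2 : IsIso (g ≫ f) := h'.isIso_of_comp_eq _ (by rw [Category.assoc, hf, hg])
  have : IsSplitMono f := ⟨⟨g ≫ inv (f ≫ g), by rw [← Category.assoc, IsIso.hom_inv_id]⟩⟩
  have : Epi f := by
    have : Epi (g ≫ f) := inferInstance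
    exact epi_of_epi g f
  have : IsIso f := isIso_of_epi_of_isSplitMono f
  exact ⟨asIso f, hf⟩

/-- Covers by the componentwise torsion free representations. The torsion free class is itself
componentwise, and reduced torsion free objects over `X` are bounded in size; with the finite type
condition coming from `hA` this suffices, so `hQ`, `hB` and `hfaithful` are not used. -/
theorem mainTheorem1 (Q : Type u) [Quiver.{u} Q] (hQ : IsSourceInjective Q)
    (hB : HasFiniteTargets Q) (R : Type u) [Ring R]
    (T F : ObjectProperty (ModuleCat.{u} R)) (hTF : IsHereditaryTorsionTheory T F)
    (hfaithful : F (ModuleCat.of R R)) (hA : DirectSumsInjective F) (X : QuiverRep Q R) :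
    ∃ (X' : QuiverRep Q R) (ψ : X' ⟶ X), IsCover (componentwiseTorsionFree Q T) ψ ∧
      ∀ (X'' : QuiverRep Q R) (ψ' : X'' ⟶ X), IsCover (componentwiseTorsionFree Q T) ψ' →
        ∃ e : X' ≅ X'', e.hom ≫ ψ' = ψ := by
  obtain ⟨X', ψ, hψ⟩ :=
    hTF.isGabrielTopology.exists_torsFree_cover (hTF.isFiniteTypeTopology hA) X
  rw [← hTF.componentwiseTorsionFree_eq Q] at hψ
  exact ⟨X', ψ, hψ, fun X'' ψ' hψ' => hψ.exists_iso hψ'⟩
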